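/- Let $(S,\cdot)$ be a (nonempty) semigroup. Let $\beta S$ be the set of ultrafilters on $S$ with the extended operation: $A\in pq$ if and only if $\{s\in S:s^{-1}A\in q\}\in p$, where $s^{-1}A=\{t\in S: st\in A\}$. A minimal left ideal of $\beta S$ is a nonempty $L\subseteq\beta S$ with $\beta S\cdot L\subseteq L$ that is inclusion-minimal among such sets. Say that $S$ satisfies the Strong Følner Condition (SFC) if for every finite nonempty $H\subseteq S$ and every $\epsilon>0$ there is a finite nonempty $K\subseteq S$ with $|K\setminus sK|<\epsilon|K|$ for all $s\in H$. When $S$ satisfies SFC, the Følner density $d(A)$ of $A\subseteq S$ is the supremum of all $\alpha\in[0,1]$ such that for every finite nonempty $H\subseteq S$ and every $\epsilon>0$ there is a finite nonempty $K\subseteq S$ with $|K\setminus sK|<\epsilon|K|$ for all $s\in H$ and $|A\cap K|\ge\alpha|K|$. For $s,t\in S$ write $s\preceq t$ if $st=t$ or $s=t$. (1) Suppose that every minimal left ideal of $\beta S$ is a singleton. Then $S$ satisfies SFC (so that $d$ is defined), and $\preceq$ directs $S$: it is reflexive and transitive, and any two elements of $S$ have a common upper bound. Moreover, for every $A\subseteq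 S$ the following are equivalent: (a) $d(A)>0$; (b) $d(A)=1$; (c) $A$ is cofinal, i.e. for every $s\in S$ there is $t\in A$ with $s\preceq t$. (2) Suppose that $S$ has a right zero, and let $Z=\{z\in S: sz=z\text{ for all }s\in S\}$. Then $S$ satisfies SFC, and for every $A\subseteq S$, $d(A)=1$ if $A\cap Z\neq\emptyset$ and $d(A)=0$ if $A\cap Z=\emptyset$. -/

import Mathlib

namespace FolnerDensity

/-- A left ideal of `T`: a nonempty subset `L` with `T * L ⊆ L`. -/
def IsLeftIdeal {T : Type*} [Mul T] (L : Set T) : Prop :=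
  L.Nonempty ∧ ∀ q : T, ∀ p ∈ L, q * p ∈ L

/-- A left ideal which is minimal, with respect to inclusion, among all left ideals. -/
def IsMinimalLeftIdeal {T : Type*} [Mul T] (L : Set T) : Prop :=
  Minimal IsLeftIdeal L

section

attribute [local instance] Ultrafilter.mul

/-- In `βS` (the ultrafilters on `S`), the operation is the one for which `A ∈ p * q` if and only
if `{s | {t | s * t ∈ A} ∈ q} ∈ p`. -/
theorem mem_ultrafilter_mul {S : Type*} [Semigroup S] (p q : Ultrafilter S) (A : Set S) :
    A ∈ p * q ↔ {s : S | {t : S | s * t ∈ A} ∈ q} ∈ p :=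
  Iff.rfl

/-- All minimal left ideals of the semigroup `βS` are singletons. -/
def BetaMinimalLeftIdealsAreSingletons (S : Type*) [Semigroup S] : Prop :=
  ∀ L : Set (Ultrafilter S), IsMinimalLeftIdeal L → ∃ p : Ultrafilter S, L = {p}

end

open Classical in
/-- For every `s ∈ H`, `|K \ sK| < ε * |K|`. -/
def IsInvariant {S : Type*} [Mul S] (H : Finset S) (ε : ℝ) (K : Finset S) : Prop :=
  ∀ s ∈ H, ((K \ K.image (fun t => s * t)).card : ℝ) < ε * (K.card : ℝ)

/-- The Strong Følner Condition. -/
def SFC (S : Type*) [Mul S] : Prop :=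
  ∀ H : Finset S, H.Nonempty → ∀ ε : ℝ, 0 < ε →
    ∃ K : Finset S, K.Nonempty ∧ IsInvariant H ε K

open Classical in
/-- The Følner density of `A`, for `S` satisfying the Strong Følner Condition. -/
noncomputable def density {S : Type*} [Mul S] (A : Set S) : ℝ :=
  sSup {α : ℝ | α ∈ Set.Icc (0 : ℝ) 1 ∧
    ∀ H : Finset S, H.Nonempty → ∀ ε : ℝ, 0 < ε →
      ∃ K : Finset S, K.Nonempty ∧ IsInvariant H ε K ∧
        α * (K.card : ℝ) ≤ ((K.filter (fun t => t ∈ A)).card : ℝ)}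

/-- The relation `s ≼ t`. -/
def AbsorbLE {S : Type*} [Mul S] (s t : S) : Prop :=
  s * t = t ∨ s = t

/-- `A` is cofinal with respect to the relation `r`. -/
def IsCofinalFor {S : Type*} (r : S → S → Prop) (A : Set S) : Prop :=
  ∀ s : S, ∃ t ∈ A, r s t

/-- The set of right zeros of `S`. -/
def rightZeros (S : Type*) [Mul S] : Set S :=
  {z : S | ∀ s : S, s * z = z}

end FolnerDensity

/-! If `{p}` is a left ideal of `βS`, each map `t ↦ s * t` preserves `p`, so by Katětov's theorem it
is the identity on a `p`-large set. Hence every finite `H` has a common `t` with `s * t = t`, and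
`{t}` is an exactly invariant Følner set: this gives SFC, directedness, and density one for cofinal
sets. Conversely, a nearly `u`-invariant set lies mostly in `uS`, so a set missing `uS` has density
zero. Right zeros feed the same two density lemmas. -/

namespace FolnerDensity

open Filter

section FixedPoints

variable {X : Type*} {f : X → X} {U : Ultrafilter X}

/-- A function invariant under an ultrafilter cannot flip a two-colouring on a large set. -/
theorem not_eventually_flip (hf : Tendsto f U U) (g : X → ℕ) :
    ¬ ∀ᶠ x in U, (Even (g (f x)) ↔ ¬ Even (g x)) := by
  intro h
  rcases U.em (fun x => Even (g x)) with he | he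
  · obtain ⟨x, h₁, h₂, h₃⟩ := (h.and (he.and (hf.eventually he))).exists
    exact h₁.1 h₃ h₂
  · obtain ⟨x, h₁, h₂, h₃⟩ := (h.and (he.and (hf.eventually he))).exists
    exact h₃ (h₁.2 h₂)

/-- A large set is not left by iteration of an invariant function. -/
theorem eventually_forall_iterate (hf : Tendsto f U U) {P : X → Prop} (hP : ∀ᶠ x in U, P x) :
    ∀ᶠ x in U, ∀ n, P (f^[n] x) := by
  by_contra hn
  rw [← Ultrafilter.eventually_not] at hn
  -- Colour by the exit time from `P`, which `f` lowers by one.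
  refine not_eventually_flip hf (fun x => sInf {n | ¬ P (f^[n] x)}) ?_
  filter_upwards [hP, hn] with x hx hex
  push Not at hex
  have hne : {n | ¬ P (f^[n] x)}.Nonempty := hex
  have hpos : sInf {n | ¬ P (f^[n] x)} ≠ 0 := fun h0 => by
    have := Nat.sInf_mem hne
    rw [h0] at this
    exact this hx
  have hmem := Nat.sInf_mem hne
  obtain ⟨k, hk⟩ := Nat.exists_eq_succ_of_ne_zero hpos
  have hk' : sInf {n | ¬ P (f^[n] (f x))} = k := by
    rw [hk] at hmem
    have hmem₀ : k ∈ {n | ¬ P (f^[n] (f x))} := hmem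
    apply le_antisymm (Nat.sInf_le hmem₀)
    have hmem' := Nat.sInf_mem (s := {n | ¬ P (f^[n] (f x))}) ⟨k, hmem₀⟩
    have : sInf {n | ¬ P (f^[n] x)} ≤ sInf {n | ¬ P (f^[n] (f x))} + 1 := Nat.sInf_le hmem'
    omega
  rw [hk, hk', Nat.succ_eq_add_one, Nat.even_add_one, not_not]

/-- Almost no orbit of a function leaving an ultrafilter invariant is injective. -/
theorem not_eventually_injective_iterate (hf : Tendsto f U U) :
    ¬ ∀ᶠ x in U, Function.Injective (fun n => f^[n] x) := by
  intro h
  let R : Setoid X :=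
    { r := fun x y => ∃ m n, f^[m] x = f^[n] y
      iseqv :=
        { refl := fun x => ⟨0, 0, rfl⟩
          symm := fun ⟨m, n, e⟩ => ⟨n, m, e.symm⟩
          trans := fun {x y z} ⟨m, n, e⟩ ⟨k, l, e'⟩ => ⟨k + m, n + l, by
            rw [Function.iterate_add_apply, e, ← Function.iterate_add_apply, Nat.add_comm,
              Function.iterate_add_apply, e', ← Function.iterate_add_apply]⟩ } }
  let r : X → X := fun x => (Quotient.mk R x).out
  have hr : ∀ x, r (f x) = r x := fun x =>
    congrArg Quotient.out (Quotient.sound (s := R) ⟨0, 1, rfl⟩)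
  have hex : ∀ x, ∃ m n, f^[m] x = f^[n] (r x) := fun x =>
    R.symm (Quotient.mk_out (s := R) x)
  choose m n hmn using hex
  -- On an injective orbit, `m x - n x` is a signed distance to the representative `r x`; `f` lowers
  -- it by one, so its parity, that of `m x + n x`, flips.
  refine not_eventually_flip hf (fun x => m x + n x) ?_
  filter_upwards [h] with x hx
  have h₁ : f^[n x + (m (f x) + 1)] x = f^[n (f x) + m x] x := by
    rw [Function.iterate_add_apply, Function.iterate_succ_apply, hmn (f x), hr,
      ← Function.iterate_add_apply, Nat.add_comm, Function.iterate_add_apply, ← hmn x,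
      ← Function.iterate_add_apply]
  have h₂ := hx h₁
  simp only [Nat.even_iff]
  omega

/-- **Katětov's theorem**: if a function leaves an ultrafilter invariant, then it fixes almost
every point. -/
theorem eventually_fixed_of_tendsto (hf : Tendsto f U U) : ∀ᶠ x in U, f x = x := by
  obtain ⟨_, _⟩ := exists_wellFoundedLT X
  have hdesc : ¬ ∀ᶠ x in U, f x < x := fun h => by
    obtain ⟨x, hx⟩ := (eventually_forall_iterate hf h).exists
    refine (RelEmbedding.natGT (r := (· < ·)) (fun n => f^[n] x) fun n => ?_).not_wellFounded
      wellFounded_lt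
    rw [Function.iterate_succ_apply']
    exact hx n
  have hasc : ¬ ∀ᶠ x in U, x < f x := fun h => by
    refine not_eventually_injective_iterate hf ?_
    filter_upwards [eventually_forall_iterate hf h] with x hx
    refine (strictMono_nat_of_lt_succ fun n => ?_).injective
    rw [Function.iterate_succ_apply']
    exact hx n
  rw [← Ultrafilter.eventually_not] at hdesc hasc
  filter_upwards [hdesc, hasc] with x h₁ h₂
  exact le_antisymm (not_lt.1 h₂) (not_lt.1 h₁)

end FixedPoints

/-- A compact Hausdorff semigroup in which the right multiplications are continuous has a minimal
left ideal. -/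
theorem exists_isMinimalLeftIdeal {M : Type*} [Nonempty M] [Semigroup M] [TopologicalSpace M]
    [CompactSpace M] [T2Space M] (hc : ∀ r : M, Continuous (· * r)) :
    ∃ L : Set M, IsMinimalLeftIdeal L := by
  obtain ⟨L, hL⟩ : ∃ L : Set M, Minimal (· ∈ {N : Set M | IsClosed N ∧ IsLeftIdeal N}) L := by
    refine zorn_superset _ fun c hcs hchain =>
      ⟨⋂₀ c, ⟨isClosed_sInter fun t ht => (hcs ht).1, ?_, fun q p hp t ht =>
        (hcs ht).2.2 q p (hp t ht)⟩, fun s hs => Set.sInter_subset_of_mem hs⟩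
    obtain rfl | hne := c.eq_empty_or_nonempty
    · simp
    · have := hne.coe_sort
      rw [Set.sInter_eq_iInter]
      exact IsCompact.nonempty_iInter_of_directed_nonempty_isCompact_isClosed _
        (DirectedOn.directed_val (IsChain.directedOn hchain.symm))
        (fun i => (hcs i.prop).2.1) (fun i => (hcs i.prop).1.isCompact)
        (fun i => (hcs i.prop).1)
  refine ⟨L, hL.prop.2, fun N hN hNL => ?_⟩
  obtain ⟨p, hp⟩ := hN.1
  -- `M * p` is a closed left ideal inside `N`, so minimality among closed left ideals suffices.
  have hsub : Set.range (· * p) ⊆ N := Set.range_subset_iff.2 fun q => hN.2 q p hp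
  have hmem : Set.range (· * p) ∈ {N : Set M | IsClosed N ∧ IsLeftIdeal N} := by
    refine ⟨(isCompact_range (hc p)).isClosed, Set.range_nonempty _, ?_⟩
    rintro q _ ⟨t, rfl⟩
    exact ⟨q * t, mul_assoc _ _ _⟩
  exact (hL.le_of_le hmem (hsub.trans hNL)).trans hsub

attribute [local instance] Ultrafilter.semigroup in
/-- If the minimal left ideals of `βS` are singletons, then some ultrafilter contains, for every
`s`, the set of solutions of `s * t = t`. -/
theorem exists_ultrafilter_eventually_absorb {S : Type*} [Semigroup S] [Nonempty S]
    (h : BetaMinimalLeftIdealsAreSingletons S) :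
    ∃ p : Ultrafilter S, ∀ s : S, ∀ᶠ t in p, s * t = t := by
  obtain ⟨L, hL⟩ := exists_isMinimalLeftIdeal (M := Ultrafilter S) Ultrafilter.continuous_mul_left
  obtain ⟨p, rfl⟩ := h L hL
  refine ⟨p, fun s => eventually_fixed_of_tendsto fun A hA => ?_⟩
  have hp : (pure s : Ultrafilter S) * p = p := hL.prop.2 (pure s) p rfl
  have hA' : A ∈ (pure s : Ultrafilter S) * p := by rwa [hp]
  exact (mem_ultrafilter_mul _ _ _).1 hA'

section Density

variable {S : Type*} [Semigroup S]

theorem exists_absorb_finset [Nonempty S] (h : BetaMinimalLeftIdealsAreSingletons S)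
    (H : Finset S) : ∃ t : S, ∀ s ∈ H, s * t = t := by
  obtain ⟨p, hp⟩ := exists_ultrafilter_eventually_absorb h
  exact ((H.eventually_all).2 fun s _ => hp s).exists

theorem isInvariant_singleton {H : Finset S} {ε : ℝ} (hε : 0 < ε) {t : S}
    (ht : ∀ s ∈ H, s * t = t) : IsInvariant H ε {t} := by
  classical
  intro s hs
  rw [Finset.image_singleton, ht s hs, Finset.sdiff_self]
  simpa using hε

theorem sfc_of_absorb (h : ∀ H : Finset S, ∃ t : S, ∀ s ∈ H, s * t = t) : SFC S := by
  intro H _ ε hε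
  obtain ⟨t, ht⟩ := h H
  exact ⟨{t}, Finset.singleton_nonempty t, isInvariant_singleton hε ht⟩

theorem density_eq_one {A : Set S} (h : ∀ H : Finset S, ∃ t ∈ A, ∀ s ∈ H, s * t = t) :
    density A = 1 := by
  refine IsGreatest.csSup_eq ⟨⟨by simp, fun H _ ε hε => ?_⟩, fun α hα => hα.1.2⟩
  obtain ⟨t, htA, ht⟩ := h H
  exact ⟨{t}, Finset.singleton_nonempty t, isInvariant_singleton hε ht,
    by simp [Finset.filter_singleton, htA]⟩

/-- A set disjoint from `uS` has density zero. -/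
theorem density_eq_zero (hS : SFC S) {A : Set S} {u : S} (hu : ∀ k, u * k ∉ A) :
    density A = 0 := by
  classical
  refine IsGreatest.csSup_eq ⟨⟨by simp, fun H hH ε hε => ?_⟩, fun α hα => ?_⟩
  · obtain ⟨K, hK, hKi⟩ := hS H hH ε hε
    exact ⟨K, hK, hKi, by simp⟩
  · by_contra! hpos
    -- With `ε = α`: `A ∩ K ⊆ K \ uK` would give `α|K| ≤ |K \ uK| < α|K|`.
    obtain ⟨K, -, hKi, hKA⟩ := hα.2 {u} (Finset.singleton_nonempty u) α hpos
    refine (hKA.trans ?_).not_gt (hKi u (Finset.mem_singleton_self u))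
    refine Nat.cast_le.2 (Finset.card_le_card fun t ht => ?_)
    obtain ⟨htK, htA⟩ := Finset.mem_filter.1 ht
    refine Finset.mem_sdiff.2 ⟨htK, fun him => ?_⟩
    obtain ⟨k, -, rfl⟩ := Finset.mem_image.1 him
    exact hu k htA

theorem isPreorder_absorbLE : IsPreorder S (AbsorbLE (S := S)) where
  refl _ := Or.inr rfl
  trans s t u := by
    rintro (hst | rfl) (htu | rfl)
    · exact Or.inl (by rw [← htu, ← mul_assoc, hst])
    · exact Or.inl hst
    · exact Or.inl htu
    · exact Or.inr rfl

theorem density_tfae (h : ∀ H : Finset S, ∃ t : S, ∀ s ∈ H, s * t = t)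
    (A : Set S) :
    [0 < density A, density A = 1, IsCofinalFor (AbsorbLE (S := S)) A].TFAE := by
  tfae_have 2 → 1 := fun h₁ => h₁ ▸ one_pos
  tfae_have 1 → 3 := by
    intro hpos s
    obtain ⟨u, hu⟩ := h {s}
    have hsu : s * u = u := hu s (Finset.mem_singleton_self s)
    by_contra! hA
    -- Every element of `uS` lies above `s`, so `A` misses `uS`.
    refine hpos.ne' (density_eq_zero (sfc_of_absorb h) (u := u) fun k hk => hA _ hk (Or.inl ?_))
    rw [← mul_assoc, hsu]
  tfae_have 3 → 2 := by
    intro hA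
    refine density_eq_one fun H => ?_
    obtain ⟨u, hu⟩ := h H
    obtain ⟨t, htA, htu | rfl⟩ := hA u
    · exact ⟨t, htA, fun s hs => by rw [← htu, ← mul_assoc, hu s hs]⟩
    · exact ⟨u, htA, hu⟩
  tfae_finish

end Density

end FolnerDensity

theorem mainTheorem10 {S : Type*} [Semigroup S] [Nonempty S] :
    (FolnerDensity.BetaMinimalLeftIdealsAreSingletons S →
      FolnerDensity.SFC S ∧
      IsPreorder S (FolnerDensity.AbsorbLE (S := S)) ∧
      IsDirected S (FolnerDensity.AbsorbLE (S := S)) ∧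
      ∀ A : Set S,
        [0 < FolnerDensity.density A,
         FolnerDensity.density A = 1,
         FolnerDensity.IsCofinalFor (FolnerDensity.AbsorbLE (S := S)) A].TFAE) ∧
    ((FolnerDensity.rightZeros S).Nonempty →
      FolnerDensity.SFC S ∧
      ∀ A : Set S,
        ((A ∩ FolnerDensity.rightZeros S).Nonempty → FolnerDensity.density A = 1) ∧
        (A ∩ FolnerDensity.rightZeros S = ∅ → FolnerDensity.density A = 0)) := by

  classical
  refine ⟨fun h => ?_, fun ⟨z, hz⟩ => ?_⟩
  · have habs := FolnerDensity.exists_absorb_finset h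
    refine ⟨FolnerDensity.sfc_of_absorb habs, FolnerDensity.isPreorder_absorbLE,
      ⟨fun s t => ?_⟩, FolnerDensity.density_tfae habs⟩
    obtain ⟨u, hu⟩ := habs {s, t}
    exact ⟨u, Or.inl (hu s (by simp)), Or.inl (hu t (by simp))⟩
  · have hS : FolnerDensity.SFC S := FolnerDensity.sfc_of_absorb fun _ => ⟨z, fun s _ => hz s⟩
    refine ⟨hS, fun A => ⟨fun ⟨t, htA, ht⟩ =>
      FolnerDensity.density_eq_one fun _ => ⟨t, htA, fun s _ => ht s⟩, fun hA =>
      FolnerDensity.density_eq_zero hS (u := z) fun k hk => ?_⟩⟩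
    -- `zS` consists of right zeros, so `A` misses it.
    exact Set.eq_empty_iff_forall_notMem.1 hA (z * k)
      ⟨hk, fun s => by rw [← mul_assoc, hz s]⟩
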